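/- Let $X$ be a nonempty, convex and compact subset of a real Hausdorff locally convex topological vector space $E$, with the topology induced by $E$, and let $A:X\to 2^{X}$ and $P:X\times X\to 2^{X}$ be correspondences, i.e. set-valued maps whose values are (possibly empty) subsets of $X$. Let $\overline{A}:X\to 2^X$ be the correspondence whose graph is the closure of the graph of $A$: $$\overline{A}(x)=\{y\in X:(x,y)\in \mathrm{cl}_{X\times X}\,\mathrm{Gr}\,A\},\qquad \mathrm{Gr}\,A=\{(x,y)\in X\times X: y\in A(x)\}.$$ Assume that: a) for each $x\in X$ the set $A(x)$ is nonempty and convex, and $A$ has open lower sections, i.e. for each $y\in X$ the set $A^{-1}(y)=\{x\in X:y\in A(x)\}$ is open in $X$; b) for each $x\in X$ the set $\{y\in X:\overline{A}(x)\cap P(x,y)=\emptyset\}\cap A(x)$ is nonempty; c) for each $x\in X$ the set $\{y\in X:\overline{A}(x)\cap P(x,y)=\emptyset\}$ is convex; d) for each $y\in X$ the set $\{x\in X:\overline{A}(x)\cap P(x,y)=\emptyset\}$ is open in $X$. Then there exists $x^{\ast}\in X$ such that $x^{\ast}\in A(x^{\ast})$ and $A(x^{\ast})\cap P(x^{\ast},x^{\ast})=\emptyset$.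 -/

import Mathlib

/-! Correspondences (set-valued maps) `T : S → 2^Y`, written `T : S → Set Y`. -/

namespace Correspondence

/-- The graph `Gr T` of a correspondence. -/
def graph {S Y : Type*} (T : S → Set Y) : Set (S × Y) :=
  {p | p.2 ∈ T p.1}

/-- The correspondence `T̄` given by `T̄ x = {y | (x, y) ∈ cl (Gr T)}`, the closure being taken
in the product `S × Y`. -/
def adherence {S Y : Type*} [TopologicalSpace S] [TopologicalSpace Y] (T : S → Set Y) :
    S → Set Y :=
  fun x => {y | (x, y) ∈ closure (graph T)}

/-- The lower section `T⁻¹ y = {x | y ∈ T x}`. -/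
def lowerSection {S Y : Type*} (T : S → Set Y) (y : Y) : Set S :=
  {x | y ∈ T x}

/-- `T` has open lower sections: every `T⁻¹ y` is open. -/
def HasOpenLowerSections {S Y : Type*} [TopologicalSpace S] (T : S → Set Y) : Prop :=
  ∀ y : Y, IsOpen (lowerSection T y)

/-- Convexity of a subset of `X`, where `X` is a subset of a real vector space `E`: it is
convex as a subset of `E`. -/
def ConvexIn {E : Type*} [AddCommGroup E] [Module ℝ E] {X : Set E} (S : Set X) : Prop :=
  Convex ℝ ((fun x : X => (x : E)) '' S)

end Correspondence

/-! Intersect `A x` with the set of `y` for which `adherence A x` misses `P (x, y)`. The resulting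
correspondence has nonempty convex values and open lower sections, so Browder's theorem gives it a
fixed point, and `A x ⊆ adherence A x` turns that point into the required equilibrium.

Browder's theorem reduces to Brouwer's: a partition of unity subordinate to finitely many lower
sections gives a continuous selection into a polytope, and Brouwer is applied to its weights.
Brouwer on the simplex is proved from Scarf's lemma, `exists_room_image_eq_univ`, a parity count of
doors and rooms. Ranking grid points by their coordinates makes a dominant set confine its grid
points to a small box (`exists_box`), which takes the place of Sperner's lemma. -/

namespace Scarf

open Finset

/-! ### Dominant sets and their least elements -/

variable {I V : Type*}

/-- A finite set `σ` is dominant for the family of rankings `r` if no vertex lies strictly above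
the `r i`-least element of `σ` for every `i`. -/
def Dominant (r : I → V → ℕ) (σ : Finset V) : Prop :=
  ∀ y, ∃ i, ∀ x ∈ σ, r i y ≤ r i x

/-- `a i` is the `r i`-least element of `δ`. -/
def IsArgmin (r : I → V → ℕ) (δ : Finset V) (a : I → V) : Prop :=
  ∀ i, a i ∈ δ ∧ ∀ x ∈ δ, r i (a i) ≤ r i x

/-- `p` and `q` are the only two distinct indices at which `a` takes the same value. -/
def OnlyCollision (a : I → V) (p q : I) : Prop :=
  p ≠ q ∧ a p = a q ∧ ∀ i j, a i = a j → i = j ∨ (i = p ∧ j = q) ∨ (i = q ∧ j = p)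

/-- `x` is the `r s`-greatest vertex among those above `a i` for every `i ≠ s`. -/
def IsTop (r : I → V → ℕ) (a : I → V) (s : I) (x : V) : Prop :=
  (∀ i, i ≠ s → r i (a i) < r i x) ∧
    ∀ y, (∀ i, i ≠ s → r i (a i) < r i y) → r s y ≤ r s x

lemma Dominant.mono {r : I → V → ℕ} {σ τ : Finset V} (h : Dominant r σ) (hτ : τ ⊆ σ) :
    Dominant r τ := fun y => by
  obtain ⟨i, hi⟩ := h y
  exact ⟨i, fun x hx => hi x (hτ hx)⟩

lemma exists_isArgmin (r : I → V → ℕ) {δ : Finset V} (hδ : δ.Nonempty) :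
    ∃ a, IsArgmin r δ a := by
  have h : ∀ i, ∃ x, x ∈ δ ∧ ∀ y ∈ δ, r i x ≤ r i y := fun i => by
    obtain ⟨x, hx, hm⟩ := exists_min_image δ (r i) hδ
    exact ⟨x, hx, hm⟩
  choose a ha using h
  exact ⟨a, ha⟩

lemma OnlyCollision.symm {a : I → V} {p q : I} (h : OnlyCollision a p q) :
    OnlyCollision a q p :=
  ⟨h.1.symm, h.2.1.symm, fun i j hij => by have := h.2.2 i j hij; tauto⟩

lemma IsArgmin.exists_eq {r : I → V → ℕ} (hr : ∀ i, Function.Injective (r i)) {δ : Finset V}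
    {a : I → V} (ha : IsArgmin r δ a) (hd : Dominant r δ) {x : V} (hx : x ∈ δ) :
    ∃ i, a i = x := by
  obtain ⟨i, hi⟩ := hd x
  exact ⟨i, hr i (le_antisymm ((ha i).2 x hx) (hi _ (ha i).1))⟩

/-- Dominance makes `a` surjective onto `δ`, which has one element fewer than `I`; so `a` becomes
injective once either colliding index is erased. -/
lemma IsArgmin.exists_onlyCollision [Fintype I] [DecidableEq I] [DecidableEq V]
    {r : I → V → ℕ} (hr : ∀ i, Function.Injective (r i)) {δ : Finset V}
    {a : I → V} (ha : IsArgmin r δ a) (hd : Dominant r δ) (hc : #δ + 1 = Fintype.card I) :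
    ∃ p q, OnlyCollision a p q := by
  obtain ⟨p, -, q, -, hpq, he⟩ : ∃ p ∈ (univ : Finset I), ∃ q ∈ (univ : Finset I),
      p ≠ q ∧ a p = a q :=
    exists_ne_map_eq_of_card_lt_of_maps_to (t := δ) (by rw [card_univ]; omega)
      (fun i _ => (ha i).1)
  have inj : ∀ p q, p ≠ q → a p = a q → Set.InjOn a ((univ.erase p : Finset I) : Set I) := by
    intro p q hpq he
    have him : (univ.erase p).image a = δ := by
      ext x
      constructor
      · intro hx
        obtain ⟨i, -, rfl⟩ := mem_image.1 hx
        exact (ha i).1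
      · intro hx
        obtain ⟨i, rfl⟩ := ha.exists_eq hr hd hx
        by_cases hi : i = p
        · exact mem_image.2 ⟨q, by simp [hpq.symm], by rw [hi, he]⟩
        · exact mem_image.2 ⟨i, by simp [hi], rfl⟩
    apply card_image_iff.1
    rw [him, card_erase_of_mem (mem_univ _), card_univ]
    omega
  refine ⟨p, q, hpq, he, fun i j hij => ?_⟩
  by_cases hip : i = p
  · by_cases hjq : j = q
    · exact Or.inr (Or.inl ⟨hip, hjq⟩)
    · left
      exact inj q p hpq.symm he.symm (by simp [hip, hpq]) (by simp [hjq]) hij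
  · by_cases hjp : j = p
    · by_cases hiq : i = q
      · exact Or.inr (Or.inr ⟨hiq, hjp⟩)
      · left
        exact inj q p hpq.symm he.symm (by simp [hiq]) (by simp [hjp, hpq]) hij
    · left
      exact inj p q hpq he (by simp [hip]) (by simp [hjp]) hij

/-! ### Enlarging a dominant set by one vertex -/

section Tops

variable {r : I → V → ℕ} {δ : Finset V} {a : I → V} {p q : I}

lemma IsTop.le (ha : IsArgmin r δ a) (hd : Dominant r δ) {x : V} (hx : IsTop r a p x) :
    r p x ≤ r p (a p) := by
  obtain ⟨i, hi⟩ := hd x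
  have h := hi _ (ha i).1
  by_cases hip : i = p
  · rwa [hip] at h
  · exact absurd (hx.1 i hip) (not_lt.2 h)

lemma IsTop.notMem (hr : ∀ i, Function.Injective (r i)) (ha : IsArgmin r δ a)
    (hd : Dominant r δ) (hpq : OnlyCollision a p q) {x : V} (hx : IsTop r a p x) : x ∉ δ := by
  intro hxδ
  obtain ⟨i, rfl⟩ := ha.exists_eq hr hd hxδ
  by_cases hip : i = p
  · subst hip
    have := hx.1 q hpq.1.symm
    rw [hpq.2.1] at this
    exact lt_irrefl _ this
  · exact lt_irrefl _ (hx.1 i hip)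

lemma IsTop.dominant_insert [DecidableEq V] (ha : IsArgmin r δ a) (hd : Dominant r δ) {x : V}
    (hx : IsTop r a p x) : Dominant r (insert x δ) := by
  intro y
  by_contra! hy
  have hlt : ∀ i, i ≠ p → r i (a i) < r i y := by
    intro i hi
    obtain ⟨z, hz, hzy⟩ := hy i
    rcases mem_insert.1 hz with rfl | hz
    · exact (hx.1 i hi).trans hzy
    · exact ((ha i).2 z hz).trans_lt hzy
  have h1 := hx.2 y hlt
  obtain ⟨z, hz, hzy⟩ := hy p
  rcases mem_insert.1 hz with rfl | hz
  · omega
  · have := (ha p).2 z hz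
    have := hx.le ha hd
    omega

/-- Each element of `δ` must stay least in some ranking after `x` is added, while `x` itself is
least in some ranking `s`. Hence `s` can only be one of the two colliding indices, and dominance
then forces maximality of `x` in ranking `s`. -/
lemma isTop_or_isTop [DecidableEq V] (hr : ∀ i, Function.Injective (r i))
    (ha : IsArgmin r δ a) (hpq : OnlyCollision a p q) {x : V} (hxδ : x ∉ δ)
    (hd : Dominant r (insert x δ)) : IsTop r a p x ∨ IsTop r a q x := by
  have key : ∀ j, ∃ i, a i = a j ∧ r i (a i) < r i x := by
    intro j
    obtain ⟨i, hi⟩ := hd (a j)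
    have he : a i = a j := hr i (le_antisymm ((ha i).2 _ (ha j).1)
      (hi _ (mem_insert_of_mem (ha i).1)))
    refine ⟨i, he, lt_of_le_of_ne (he ▸ hi x (mem_insert_self _ _)) fun h => hxδ ?_⟩
    rw [← hr i h]
    exact (ha i).1
  have top : ∀ p q, OnlyCollision a p q → r p x ≤ r p (a p) → IsTop r a p x := by
    intro p q hpq hp
    refine ⟨fun j hj => ?_, fun y hy => ?_⟩
    · obtain ⟨i, hi, hlt⟩ := key j
      rcases hpq.2.2 i j hi with rfl | ⟨rfl, -⟩ | ⟨-, rfl⟩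
      · exact hlt
      · omega
      · exact absurd rfl hj
    · obtain ⟨i, hi⟩ := hd y
      by_cases hip : i = p
      · subst hip
        exact hi x (mem_insert_self _ _)
      · exact absurd (hy i hip) (not_lt.2 (hi _ (mem_insert_of_mem (ha i).1)))
  obtain ⟨s, hs⟩ := hd x
  have hs' := hs _ (mem_insert_of_mem (ha s).1)
  obtain ⟨i, hi, hlt⟩ := key s
  rcases hpq.2.2 i s hi with rfl | ⟨-, rfl⟩ | ⟨-, rfl⟩
  · omega
  · exact Or.inr (top _ _ hpq.symm hs')
  · exact Or.inl (top _ _ hpq hs')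

lemma IsTop.unique (hr : ∀ i, Function.Injective (r i)) {x y : V} (hx : IsTop r a p x)
    (hy : IsTop r a p y) : x = y :=
  hr p (le_antisymm (hy.2 x hx.1) (hx.2 y hy.1))

lemma IsTop.ne (ha : IsArgmin r δ a) (hd : Dominant r δ) (hpq : p ≠ q) {x y : V}
    (hx : IsTop r a p x) (hy : IsTop r a q y) : x ≠ y := by
  rintro rfl
  have := hx.1 q hpq.symm
  have := hy.le ha hd
  omega

lemma exists_isTop [Finite V] {y : V} (hy : ∀ i, i ≠ p → r i (a i) < r i y) :
    ∃ x, IsTop r a p x := by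
  have := Fintype.ofFinite V
  classical
  obtain ⟨x, hx, hm⟩ := exists_max_image
    ({y | ∀ i, i ≠ p → r i (a i) < r i y} : Finset V) (r p) ⟨y, by simpa using hy⟩
  simp only [mem_filter, mem_univ, true_and] at hx hm
  exact ⟨x, hx, hm⟩

end Tops

/-- The slack vertices `e i`: each is least in its own ranking and above all ordinary vertices in
the other rankings. -/
structure IsSlack (r : I → V → ℕ) (e : I → V) : Prop where
  inj : ∀ i, Function.Injective (r i)
  bot : ∀ i v, r i (e i) ≤ r i v
  top : ∀ i j v, j ≠ i → v ∉ Set.range e → r i v < r i (e j)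
  e_inj : Function.Injective e

lemma IsSlack.lt {r : I → V → ℕ} {e : I → V} (h : IsSlack r e) {i j : I} (hij : i ≠ j) : r i (e i) < r i (e j) :=
  lt_of_le_of_ne (h.bot i _) fun h' => hij (h.e_inj (h.inj i h'))

lemma dominant_boundary [Fintype I] [DecidableEq I] [DecidableEq V] [Nontrivial I]
    {r : I → V → ℕ} {e : I → V} (h : IsSlack r e) (k : I) :
    Dominant r ((univ.erase k).image e) := by
  intro y
  by_cases hy : ∃ j, j ≠ k ∧ y = e j
  · obtain ⟨j, -, rfl⟩ := hy
    exact ⟨j, fun x _ => h.bot j x⟩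
  · refine ⟨k, fun x hx => ?_⟩
    obtain ⟨m, hm, rfl⟩ := mem_image.1 hx
    by_cases hk : y = e k
    · rw [hk]; exact h.bot _ _
    · refine (h.top k m y (ne_of_mem_erase hm) ?_).le
      rintro ⟨j, rfl⟩
      exact hy ⟨j, fun hjk => hk (by rw [hjk]), rfl⟩

/-! ### Rooms, doors and the parity argument -/

section Rooms

variable [Fintype I] [Fintype V]
  {r : I → V → ℕ} {e : I → V} {δ : Finset V}

/-- The dominant sets with as many elements as there are rankings. -/
noncomputable def rooms (r : I → V → ℕ) : Finset (Finset V) := by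
  classical exact {σ | #σ = Fintype.card I ∧ Dominant r σ}

lemma mem_rooms {σ : Finset V} : σ ∈ rooms r ↔ #σ = Fintype.card I ∧ Dominant r σ := by
  simp [rooms]

lemma exists_insert_of_subset_room [DecidableEq V] (hc : #δ + 1 = Fintype.card I) {σ : Finset V}
    (hσ : σ ∈ rooms r) (h : δ ⊆ σ) : ∃ x ∉ δ, σ = insert x δ := by
  obtain ⟨x, hx, he⟩ := (covBy_iff_exists_insert.1
    (covBy_iff_card_sdiff_eq_one.2 ⟨h, by
      rw [card_sdiff_of_subset h, (mem_rooms.1 hσ).1]; omega⟩))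
  exact ⟨x, hx, he.symm⟩

variable [DecidableEq I]

/-- The dominant sets whose elements carry each color except `k` exactly once. -/
noncomputable def doors (r : I → V → ℕ) (c : V → I) (k : I) : Finset (Finset V) := by
  classical exact {δ | #δ + 1 = Fintype.card I ∧ Dominant r δ ∧ δ.image c = univ.erase k}

lemma mem_doors {c : V → I} {k : I} : δ ∈ doors r c k ↔
    #δ + 1 = Fintype.card I ∧ Dominant r δ ∧ δ.image c = univ.erase k := by
  simp [doors]

variable [DecidableEq V]

/-- The two rooms come from the tops at the two colliding indices. These exist because no `a i` is a
slack vertex other than `e i`: otherwise `δ` would consist of slack vertices different from `e i`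
and, by cardinality, be a boundary set. -/
lemma card_rooms_of_ne_boundary (h : IsSlack r e) (hδ : δ.Nonempty) (hd : Dominant r δ)
    (hc : #δ + 1 = Fintype.card I) (hb : ∀ k, δ ≠ (univ.erase k).image e) :
    #{σ ∈ rooms r | δ ⊆ σ} = 2 := by
  obtain ⟨a, ha⟩ := exists_isArgmin r hδ
  obtain ⟨p, q, hpq⟩ := ha.exists_onlyCollision h.inj hd hc
  have hN : ∀ i, a i = e i ∨ a i ∉ Set.range e := by
    intro i
    by_contra! hi
    obtain ⟨hi, j, hj⟩ := hi
    have hji : j ≠ i := fun h => hi (by rw [← hj, h])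
    apply hb i
    refine eq_of_subset_of_card_le (fun z hz => ?_) ?_
    · have hle := (ha i).2 z hz
      rw [← hj] at hle
      have hz' : z ∈ Set.range e := by
        by_contra hz'
        exact absurd (h.top i j z hji hz') (not_lt.2 hle)
      obtain ⟨k, rfl⟩ := hz'
      refine mem_image_of_mem _ (mem_erase.2 ⟨?_, mem_univ _⟩)
      rintro rfl
      exact absurd (h.lt hji.symm) (not_lt.2 hle)
    · rw [card_image_of_injective _ h.e_inj, card_erase_of_mem (mem_univ _), card_univ]
      omega
  have hS : ∀ s, ∃ x, IsTop r a s x := by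
    intro s
    refine exists_isTop (y := e s) fun i hi => ?_
    rcases hN i with h' | h'
    · rw [h']
      exact h.lt hi
    · exact h.top i s _ hi.symm h'
  obtain ⟨x, hx⟩ := hS p
  obtain ⟨y, hy⟩ := hS q
  have hxδ := hx.notMem h.inj ha hd hpq
  have hyδ := hy.notMem h.inj ha hd hpq.symm
  have : ({σ ∈ rooms r | δ ⊆ σ} : Finset (Finset V)) = {insert x δ, insert y δ} := by
    ext σ
    simp only [mem_filter, mem_insert, mem_singleton]
    constructor
    · rintro ⟨hσ, hs⟩
      obtain ⟨z, hz, rfl⟩ := exists_insert_of_subset_room hc hσ hs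
      rcases isTop_or_isTop h.inj ha hpq hz (mem_rooms.1 hσ).2 with hz | hz
      · left; rw [hz.unique h.inj hx]
      · right; rw [hz.unique h.inj hy]
    · rintro (rfl | rfl)
      · exact ⟨mem_rooms.2 ⟨by rw [card_insert_of_notMem hxδ, hc], hx.dominant_insert ha hd⟩,
          subset_insert _ _⟩
      · exact ⟨mem_rooms.2 ⟨by rw [card_insert_of_notMem hyδ, hc], hy.dominant_insert ha hd⟩,
          subset_insert _ _⟩
  rw [this]
  refine card_pair fun he => hx.ne ha hd hpq.1 hy ?_
  have : x ∈ insert y δ := he ▸ mem_insert_self x δ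
  exact (mem_insert.1 this).resolve_right hxδ

/-- Here `a i = e i` for `i ≠ k`, and `a k = e m` collides with `a m`. A top exists at `k`, but none
at `m`: it would lie above `e m` in ranking `k`, hence be some `e j` with `j ≠ k, m`, and would have
to exceed itself in ranking `j`. -/
lemma card_rooms_boundary [Nontrivial I] (h : IsSlack r e) (k : I) :
    #{σ ∈ rooms r | (univ.erase k).image e ⊆ σ} = 1 := by
  set δ := (univ.erase k).image e with hδ
  have hne : δ.Nonempty := by
    obtain ⟨m, hm⟩ := exists_ne k
    exact ⟨e m, mem_image_of_mem _ (by simp [hm])⟩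
  have hd : Dominant r δ := dominant_boundary h k
  have hpos : 0 < Fintype.card I := Fintype.card_pos
  have hc : #δ + 1 = Fintype.card I := by
    rw [hδ, card_image_of_injective _ h.e_inj, card_erase_of_mem (mem_univ _), card_univ]
    omega
  obtain ⟨a, ha⟩ := exists_isArgmin r hne
  have hae : ∀ i, i ≠ k → a i = e i := fun i hi =>
    h.inj i (le_antisymm ((ha i).2 _ (mem_image_of_mem _ (by simp [hi]))) (h.bot _ _))
  obtain ⟨m, hm, hmk⟩ := mem_image.1 (ha k).1
  have hmk' : m ≠ k := ne_of_mem_erase hm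
  have hkm : OnlyCollision a k m := by
    obtain ⟨p, q, hpq⟩ := ha.exists_onlyCollision h.inj hd hc
    rcases hpq.2.2 k m (by rw [← hmk, hae m hmk']) with h' | ⟨rfl, rfl⟩ | ⟨rfl, rfl⟩
    · exact absurd h'.symm hmk'
    · exact hpq
    · exact hpq.symm
  obtain ⟨x, hx⟩ : ∃ x, IsTop r a k x := exists_isTop (y := e k) fun i hi => by
    rw [hae i hi]; exact h.lt hi
  have hxδ := hx.notMem h.inj ha hd hkm
  have hnot : ∀ z, ¬ IsTop r a m z := by
    intro z hz
    have hk := hz.1 k hmk'.symm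
    rw [← hmk] at hk
    by_cases hzr : z ∈ Set.range e
    · obtain ⟨j, rfl⟩ := hzr
      by_cases hjk : j = k
      · subst hjk
        exact absurd (h.bot j (e m)) (not_le.2 hk)
      · by_cases hjm : j = m
        · subst hjm; exact lt_irrefl _ hk
        · have := hz.1 j hjm
          rw [hae j hjk] at this
          exact lt_irrefl _ this
    · exact absurd (h.top k m z hmk' hzr) (not_lt.2 hk.le)
  rw [card_eq_one]
  refine ⟨insert x δ, ?_⟩
  ext σ
  simp only [mem_filter, mem_singleton]
  constructor
  · rintro ⟨hσ, hs⟩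
    obtain ⟨z, hz, rfl⟩ := exists_insert_of_subset_room hc hσ hs
    rcases isTop_or_isTop h.inj ha hkm hz (mem_rooms.1 hσ).2 with hz | hz
    · rw [hz.unique h.inj hx]
    · exact absurd hz (hnot z)
  · rintro rfl
    exact ⟨mem_rooms.2 ⟨by rw [card_insert_of_notMem hxδ, hc], hx.dominant_insert ha hd⟩,
      subset_insert _ _⟩

/-- A room with a door but not all colors repeats exactly one color, and its doors arise by deleting
either of the two vertices sharing it. -/
lemma even_card_doors {c : V → I} {k : I} {σ : Finset V} (hσ : σ ∈ rooms r)
    (hn : σ.image c ≠ univ) : Even #{δ ∈ doors r c k | δ ⊆ σ} := by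
  obtain ⟨hc, hd⟩ := mem_rooms.1 hσ
  rcases ({δ ∈ doors r c k | δ ⊆ σ} : Finset (Finset V)).eq_empty_or_nonempty with h0 | ⟨δ, hδ⟩
  · rw [h0]; simp
  obtain ⟨hδm, hs⟩ := mem_filter.1 hδ
  obtain ⟨hδc, hδd, hδi⟩ := mem_doors.1 hδm
  obtain ⟨x, hx, rfl⟩ := exists_insert_of_subset_room hδc hσ hs
  have hinj : Set.InjOn c δ := by
    apply card_image_iff.1
    rw [hδi, card_erase_of_mem (mem_univ _), card_univ]
    omega
  have hxk : c x ≠ k := by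
    intro hxk
    apply hn
    rw [image_insert, hδi, hxk, insert_erase (mem_univ _)]
  obtain ⟨y, hy, hyx⟩ : ∃ y ∈ δ, c y = c x := by
    have : c x ∈ δ.image c := by rw [hδi]; simp [hxk]
    exact mem_image.1 this
  have hxy : x ≠ y := fun h => hx (h ▸ hy)
  have himg : ((insert x δ).erase y).image c = univ.erase k := by
    rw [← hδi]
    ext i
    simp only [mem_image, mem_erase, mem_insert]
    constructor
    · rintro ⟨z, ⟨-, rfl | hz⟩, rfl⟩
      · exact ⟨y, hy, hyx⟩
      · exact ⟨z, hz, rfl⟩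
    · rintro ⟨z, hz, rfl⟩
      by_cases hzy : z = y
      · exact ⟨x, ⟨hxy, Or.inl rfl⟩, by rw [hzy, hyx]⟩
      · exact ⟨z, ⟨hzy, Or.inr hz⟩, rfl⟩
  have : ({τ ∈ doors r c k | τ ⊆ insert x δ} : Finset (Finset V)) =
      {δ, (insert x δ).erase y} := by
    ext τ
    simp only [mem_filter, mem_insert, mem_singleton]
    constructor
    · rintro ⟨hτ, hτs⟩
      obtain ⟨hτc, -, hτi⟩ := mem_doors.1 hτ
      obtain ⟨z, hz, hze⟩ := exists_insert_of_subset_room hτc hσ hτs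
      have hτe : τ = (insert x δ).erase z := by rw [hze, erase_insert hz]
      by_cases hzx : z = x
      · left; rw [hτe, hzx, erase_insert hx]
      · right
        have hxτ : x ∈ τ := by rw [hτe]; simp [Ne.symm hzx]
        by_cases hzy : z = y
        · rw [hτe, hzy]
        · exfalso
          have hyτ : y ∈ τ := by rw [hτe]; simp [Ne.symm hzy, hy]
          have hτinj : Set.InjOn c τ := by
            apply card_image_iff.1
            rw [hτi, card_erase_of_mem (mem_univ _), card_univ]
            omega
          exact hxy (hτinj hxτ hyτ hyx.symm)
    · rintro (rfl | rfl)
      · exact ⟨hδm, hs⟩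
      · refine ⟨mem_doors.2 ⟨?_, hd.mono (erase_subset _ _), himg⟩, erase_subset _ _⟩
        rw [card_erase_of_mem (mem_insert_of_mem hy), hc]
        omega
  rw [this, card_pair]
  · exact even_two
  · intro h
    rw [h] at hy
    simp at hy

/-- **Scarf's lemma**: some room carries all the colors. -/
theorem exists_room_image_eq_univ [Nontrivial I] (h : IsSlack r e) (c : V → I)
    (hce : ∀ i, c (e i) = i) : ∃ σ : Finset V, #σ = Fintype.card I ∧ Dominant r σ ∧
      σ.image c = univ := by
  by_contra! hno
  obtain ⟨k⟩ : Nonempty I := inferInstance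
  set b := (univ.erase k).image e with hb
  have hpos : 0 < Fintype.card I := Fintype.card_pos
  have hbi : ∀ j, ((univ.erase j).image e).image c = univ.erase j := fun j => by
    rw [image_image, show c ∘ e = id from funext hce, image_id]
  have hbd : b ∈ doors r c k := by
    refine mem_doors.2 ⟨?_, dominant_boundary h k, hbi k⟩
    rw [hb, card_image_of_injective _ h.e_inj, card_erase_of_mem (mem_univ _), card_univ]
    omega
  -- Double counting of door-room incidences: every room contributes an even number, every door but
  -- `b` contributes two, and `b` contributes one.
  have hcount := sum_card_bipartiteAbove_eq_sum_card_bipartiteBelow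
    (s := doors r c k) (t := rooms r) (fun δ σ => δ ⊆ σ)
  simp only [bipartiteAbove, bipartiteBelow] at hcount
  have heven : Even (∑ σ ∈ rooms r, #{δ ∈ doors r c k | δ ⊆ σ}) :=
    even_sum _ fun σ hσ => even_card_doors hσ
      (hno σ (mem_rooms.1 hσ).1 (mem_rooms.1 hσ).2)
  have heven' : Even (∑ δ ∈ (doors r c k).erase b, #{σ ∈ rooms r | δ ⊆ σ}) := by
    refine even_sum _ fun δ hδ => ?_
    obtain ⟨hne, hδ⟩ := mem_erase.1 hδ
    obtain ⟨hδc, hδd, hδi⟩ := mem_doors.1 hδ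
    have hδne : δ.Nonempty := by
      rw [← card_pos]
      have := Fintype.one_lt_card (α := I)
      omega
    rw [card_rooms_of_ne_boundary h hδne hδd hδc]
    · exact even_two
    · rintro j rfl
      rw [hbi] at hδi
      have : j = k := by
        by_contra hjk
        have : j ∈ univ.erase k := by simp [hjk]
        rw [← hδi] at this
        simp at this
      exact hne (by rw [this])
  rw [← hcount, ← add_sum_erase _ _ hbd, card_rooms_boundary h k] at heven
  obtain ⟨u, hu⟩ := heven
  obtain ⟨v, hv⟩ := heven'
  omega

end Rooms

end Scarf

/-! ### From Scarf's lemma to a small box on the grid -/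

namespace Scarf

open Finset

/-- The coordinates of a grid point or of a slack vertex of the simplex of size `k`. -/
def height {I : Type*} [DecidableEq I] {T : Finset (I → ℕ)} (k : ℕ) (i : I) : T ⊕ I → ℕ
  | .inl x => x.1 i + 1
  | .inr j => if j = i then 0 else k + 2

/-- A family of rankings refining `height`. -/
lemma exists_isSlack {I : Type*} [Fintype I] [DecidableEq I] (k : ℕ) {T : Finset (I → ℕ)}
    (hT : ∀ x ∈ T, ∀ i, x i ≤ k) :
    ∃ r : I → T ⊕ I → ℕ, IsSlack r Sum.inr ∧
      ∀ (i) (v w : T ⊕ I), height k i v < height k i w → r i v < r i w := by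
  classical
  obtain ⟨N, ⟨f⟩⟩ := Finite.exists_equiv_fin (T ⊕ I)
  -- The enumeration `f` has values below `N`, so it only breaks ties between equal heights.
  let r : I → T ⊕ I → ℕ := fun i v => height k i v * N + f v
  have hmono : ∀ (i) (v w : T ⊕ I), height k i v < height k i w → r i v < r i w := by
    intro i v w h
    have h1 : (height k i v + 1) * N ≤ height k i w * N := Nat.mul_le_mul_right _ h
    have h2 := (f v).2
    simp only [r]
    nlinarith
  have hzero : ∀ (i) (v : T ⊕ I), height k i v = 0 → v = Sum.inr i := by
    rintro i (x | j) h
    · simp [height] at h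
    · by_cases hj : j = i
      · rw [hj]
      · simp [height, hj] at h
  refine ⟨r, ⟨fun i v w h => ?_, fun i v => ?_, fun i j v hj hv => hmono _ _ _ ?_,
    Sum.inr_injective⟩, hmono⟩
  · rcases lt_trichotomy (height k i v) (height k i w) with h' | h' | h'
    · exact absurd h (hmono _ _ _ h').ne
    · simp only [r, h'] at h
      exact f.injective (Fin.ext (by omega))
    · exact absurd h (hmono _ _ _ h').ne'
  · rcases Nat.eq_zero_or_pos (height k i v) with h | h
    · rw [hzero i v h]
    · exact (hmono _ _ _ (by simpa [height] using h)).le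
  · rcases v with x | m
    · have := hT x.1 x.2 i
      simp only [height, if_neg hj]
      omega
    · exact absurd ⟨m, rfl⟩ hv

/-- **A Sperner-type lemma on the grid of size `k`**: for every coloring there is a small box
containing grid points of each color `i` for which the box does not touch the face `x i = 0`. -/
theorem exists_box {I : Type*} [Fintype I] [DecidableEq I] [Nontrivial I] (k : ℕ)
    (c : (I → ℕ) → I) :
    ∃ m : I → ℕ, (∃ x : I → ℕ, ∑ i, x i = k ∧ ∀ j, m j ≤ x j ∧ x j < m j + Fintype.card I) ∧
      ∀ i, m i = 0 ∨ ∃ x : I → ℕ, ∑ i, x i = k ∧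
        (∀ j, m j ≤ x j ∧ x j < m j + Fintype.card I) ∧ c x = i := by
  let T : Finset (I → ℕ) := Finset.piAntidiag univ k
  have hTmem : ∀ x, x ∈ T ↔ ∑ i, x i = k := fun x => by simp [T]
  obtain ⟨r, hr, hmono⟩ := exists_isSlack k (T := T) fun x hx i => by
    rw [← (hTmem x).1 hx]
    exact single_le_sum (f := x) (fun _ _ => Nat.zero_le _) (mem_univ i)
  obtain ⟨σ, -, hdom, himg⟩ := exists_room_image_eq_univ hr
    (Sum.elim (fun x => c x.1) id) (fun i => rfl)
  have hne : σ.Nonempty := by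
    obtain ⟨i⟩ : Nonempty I := inferInstance
    have : i ∈ σ.image (Sum.elim (fun x : T => c x.1) id) := by rw [himg]; exact mem_univ _
    obtain ⟨v, hv, -⟩ := mem_image.1 this
    exact ⟨v, hv⟩
  have hmin : ∀ i, ∃ v ∈ σ, ∀ w ∈ σ, height k i v ≤ height k i w := fun i =>
    exists_min_image σ (height k i) hne
  choose a haσ ha using hmin
  -- Undoes the shift by one in `height`; truncation gives `0` when the least height is that of the
  -- slack vertex `i`.
  let m : I → ℕ := fun i => height k i (a i) - 1
  have hm : ∀ x : T, Sum.inl x ∈ σ → ∀ i, m i ≤ x.1 i := by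
    intro x hx i
    have := ha i _ hx
    simp only [height, m] at this ⊢
    omega
  -- Otherwise a grid point with all coordinates at least `m i + 1` would lie above the minimum of
  -- `σ` in every ranking; the surplus is put on `i₀`.
  have hsum : k < ∑ i, (m i + 1) := by
    by_contra! hle
    obtain ⟨i₀⟩ : Nonempty I := inferInstance
    let y : I → ℕ := fun i => m i + 1 + if i = i₀ then k - ∑ i, (m i + 1) else 0
    have hy : y ∈ T := by
      rw [hTmem]
      have : ∑ i, y i = ∑ i, (m i + 1) + (k - ∑ i, (m i + 1)) := by
        simp only [y]
        rw [sum_add_distrib (f := fun i => m i + 1), sum_ite_eq' univ i₀, if_pos (mem_univ _)]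
      omega
    obtain ⟨i, hi⟩ := hdom (Sum.inl ⟨y, hy⟩)
    refine absurd (hi _ (haσ i)) (not_le.2 (hmono _ _ _ ?_))
    simp only [height, y, m]
    split_ifs <;> omega
  have hbox : ∀ x : T, Sum.inl x ∈ σ →
      ∀ j, m j ≤ x.1 j ∧ x.1 j < m j + Fintype.card I := by
    intro x hx j
    refine ⟨hm x hx j, ?_⟩
    have h1 : x.1 j - m j ≤ ∑ i, (x.1 i - m i) :=
      single_le_sum (f := fun i => x.1 i - m i) (fun _ _ => Nat.zero_le _) (mem_univ j)
    have h2 : ∑ i, (x.1 i - m i) + ∑ i, m i = k := by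
      rw [← sum_add_distrib, ← (hTmem x.1).1 x.2]
      exact sum_congr rfl fun i _ => Nat.sub_add_cancel (hm x hx i)
    rw [sum_add_distrib, sum_const, card_univ, smul_eq_mul, mul_one] at hsum
    have := hm x hx j
    omega
  refine ⟨m, ?_, fun i => ?_⟩
  -- With no grid point in the box, `σ` has only slack vertices, and the colors force all of them;
  -- then every minimal height is `0` and any grid point contradicts dominance.
  · by_contra! hno
    have hslack : ∀ i, m i = k + 1 ∨ m i = 0 := by
      intro i
      rcases hv : a i with x | j
      · obtain ⟨j, hj⟩ := hno x.1 ((hTmem _).1 x.2)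
        have := hbox x (hv ▸ haσ i) j
        exact absurd this.2 (not_lt.2 (hj this.1))
      · by_cases hj : j = i <;> simp [m, hv, height, hj]
    have hσ : ∀ i, Sum.inr i ∈ σ := by
      intro i
      have : i ∈ σ.image (Sum.elim (fun x : T => c x.1) id) := by rw [himg]; exact mem_univ _
      obtain ⟨x | j, hv, hi⟩ := mem_image.1 this
      · obtain ⟨j, hj⟩ := hno x.1 ((hTmem _).1 x.2)
        have := hbox x hv j
        exact absurd this.2 (not_lt.2 (hj this.1))
      · have : j = i := hi
        rwa [← this]
    obtain ⟨i₀⟩ : Nonempty I := inferInstance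
    have hy : (fun i => if i = i₀ then k else 0) ∈ T := by
      rw [hTmem, sum_ite_eq' univ i₀, if_pos (mem_univ _)]
    obtain ⟨i, hi⟩ := hdom (Sum.inl ⟨_, hy⟩)
    refine absurd (hi _ (hσ i)) (not_le.2 (hmono _ _ _ ?_))
    simp [height]
  · have : i ∈ σ.image (Sum.elim (fun x : T => c x.1) id) := by rw [himg]; exact mem_univ _
    obtain ⟨x | j, hv, hi⟩ := mem_image.1 this
    · exact Or.inr ⟨x.1, (hTmem _).1 x.2, hbox x hv, hi⟩
    · left
      have hj : j = i := hi
      have h0 : height k i (Sum.inr j : T ⊕ I) = 0 := if_pos hj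
      have := ha i _ hv
      simp only [m]
      omega

end Scarf

/-! ### Brouwer's theorem on the simplex -/

section Brouwer

open Finset

variable {I : Type*} [Fintype I]

lemma exists_le_of_mem_stdSimplex [Nonempty I] {x y : I → ℝ} (hx : x ∈ stdSimplex ℝ I)
    (hy : y ∈ stdSimplex ℝ I) : ∃ i, x i ≤ y i := by
  by_contra! h
  have := sum_lt_sum_of_nonempty (univ_nonempty (α := I)) fun i _ => h i
  rw [hx.2, hy.2] at this
  exact lt_irrefl _ this

/-- Color a grid point by a coordinate that `f` does not decrease. In a small box, each color `i`
either occurs near `x`, where uniform continuity applies, or `x i` is itself below `ε`. -/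
lemma exists_approx_fixedPoint [Nontrivial I] (f : stdSimplex ℝ I → stdSimplex ℝ I)
    (hf : Continuous f) {ε : ℝ} (hε : 0 < ε) :
    ∃ x : stdSimplex ℝ I, ∀ i, x.1 i - ε ≤ (f x).1 i := by
  classical
  have : CompactSpace (stdSimplex ℝ I) := isCompact_iff_compactSpace.1 (isCompact_stdSimplex ℝ I)
  obtain ⟨δ, hδ, hfδ⟩ := Metric.uniformContinuous_iff.1
    (CompactSpace.uniformContinuous_of_continuous hf) (ε / 2) (half_pos hε)
  set n := Fintype.card I
  obtain ⟨k, hk⟩ := exists_nat_gt ((n : ℝ) / min δ (ε / 2))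
  have hmin : 0 < min δ (ε / 2) := lt_min hδ (half_pos hε)
  have hk0 : (0 : ℝ) < k := lt_of_le_of_lt (by positivity) hk
  have hnk : (n : ℝ) / k < min δ (ε / 2) := by
    rw [div_lt_iff₀ hmin] at hk
    rw [div_lt_iff₀ hk0]
    linarith
  let s : (x : I → ℕ) → ∑ i, x i = k → stdSimplex ℝ I := fun x hx =>
    ⟨fun i => x i / k, fun i => by positivity, by
      rw [← sum_div, ← Nat.cast_sum, hx, div_self hk0.ne']⟩
  have hc : ∀ x : I → ℕ, ∃ i, ∀ hx : ∑ i, x i = k, (s x hx).1 i ≤ (f (s x hx)).1 i := by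
    intro x
    by_cases hx : ∑ i, x i = k
    · obtain ⟨i, hi⟩ := exists_le_of_mem_stdSimplex (s x hx).2 (f (s x hx)).2
      exact ⟨i, fun _ => hi⟩
    · exact ⟨Classical.arbitrary I, fun h => absurd h hx⟩
  choose c hc using hc
  obtain ⟨m, ⟨x, hx, hxm⟩, hm⟩ := Scarf.exists_box k c
  refine ⟨s x hx, fun i => ?_⟩
  rcases hm i with h0 | ⟨y, hy, hym, hyi⟩
  · have h1 : (x i : ℝ) / k ≤ n / k := by
      have := (hxm i).2
      rw [h0, zero_add] at this
      gcongr
    have h2 := (f (s x hx)).2.1 i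
    have h3 := min_le_right δ (ε / 2)
    have h4 : (s x hx).1 i = x i / k := rfl
    linarith
  · have hcoord : ∀ j, |(s x hx).1 j - (s y hy).1 j| ≤ n / k := by
      intro j
      have h4 : (s x hx).1 j - (s y hy).1 j = ((x j : ℝ) - y j) / k := (sub_div _ _ _).symm
      rw [h4, abs_div, abs_of_pos hk0]
      gcongr
      rw [abs_le]
      have h5 : x j ≤ y j + n := by have := hxm j; have := hym j; omega
      have h6 : y j ≤ x j + n := by have := hxm j; have := hym j; omega
      have h7 : (x j : ℝ) ≤ y j + n := by exact_mod_cast h5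
      have h8 : (y j : ℝ) ≤ x j + n := by exact_mod_cast h6
      constructor <;> linarith
    have hdist : dist (s x hx) (s y hy) < δ := by
      refine lt_of_le_of_lt ?_ (hnk.trans_le (min_le_left _ _))
      rw [Subtype.dist_eq]
      exact (dist_pi_le_iff (by positivity)).2 fun j => by
        rw [Real.dist_eq]; exact hcoord j
    have hfd := hfδ hdist
    rw [Subtype.dist_eq] at hfd
    have hfi := (dist_le_pi_dist (f (s x hx)).1 (f (s y hy)).1 i).trans_lt hfd
    rw [Real.dist_eq, abs_lt] at hfi
    have hci := hc y hy
    rw [hyi] at hci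
    have hi := (abs_le.1 (hcoord i)).2
    have h3 := min_le_right δ (ε / 2)
    linarith [hfi.1]

/-- **Brouwer's fixed point theorem** for the standard simplex. -/
theorem exists_fixedPoint_stdSimplex [Nonempty I] (f : stdSimplex ℝ I → stdSimplex ℝ I)
    (hf : Continuous f) : ∃ x, f x = x := by
  classical
  have hcpt : CompactSpace (stdSimplex ℝ I) :=
    isCompact_iff_compactSpace.1 (isCompact_stdSimplex ℝ I)
  have hev : ∀ i, Continuous fun x : stdSimplex ℝ I => x.1 i := fun i =>
    (continuous_apply i).comp continuous_subtype_val
  rcases subsingleton_or_nontrivial I with hI | hI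
  · obtain ⟨i⟩ : Nonempty I := inferInstance
    have hone : ∀ y : stdSimplex ℝ I, ∀ j, y.1 j = 1 := fun y j => by
      rw [← y.2.2, Fintype.sum_subsingleton _ j]
    let x : stdSimplex ℝ I := ⟨Pi.single i 1, single_mem_stdSimplex ℝ i⟩
    exact ⟨x, Subtype.ext (funext fun j => by rw [hone, hone])⟩
  let K : ℕ → Set (stdSimplex ℝ I) := fun n => {x | ∀ i, x.1 i - 1 / ((n : ℝ) + 1) ≤ (f x).1 i}
  have hK : (⋂ n, K n).Nonempty := by
    refine IsCompact.nonempty_iInter_of_sequence_nonempty_isCompact_isClosed K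
      (fun n x hx i => ?_) (fun n => exists_approx_fixedPoint f hf (by positivity)) ?_
      (fun n => ?_)
    · have h1 := hx i
      have h2 : 1 / (((n + 1 : ℕ) : ℝ) + 1) ≤ 1 / ((n : ℝ) + 1) :=
        one_div_le_one_div_of_le (by positivity) (by push_cast; linarith)
      linarith
    · refine IsClosed.isCompact ?_
      simp only [K, Set.ofPred_forall]
      exact isClosed_iInter fun i => isClosed_le ((hev i).sub continuous_const) ((hev i).comp hf)
    · simp only [K, Set.ofPred_forall]
      exact isClosed_iInter fun i => isClosed_le ((hev i).sub continuous_const) ((hev i).comp hf)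
  obtain ⟨x, hx⟩ := hK
  -- Both points have coordinate sum one, so coordinatewise inequality forces equality.
  have hle : ∀ i, x.1 i ≤ (f x).1 i := by
    intro i
    refine le_of_forall_pos_le_add fun ε hε => ?_
    obtain ⟨n, hn⟩ := exists_nat_one_div_lt hε
    have := Set.mem_iInter.1 hx n i
    linarith
  refine ⟨x, Subtype.ext (funext fun i => ?_)⟩
  exact ((sum_eq_sum_iff_of_le fun i _ => hle i).1
    (x.2.2.trans (f x).2.2.symm) i (mem_univ i)).symm

end Brouwer

/-! ### Browder's theorem and the equilibrium -/

/-- **Browder's fixed point theorem**: a correspondence with nonempty convex values and open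
lower sections on a nonempty compact convex set has a fixed point. -/
theorem Correspondence.HasOpenLowerSections.exists_mem_self {E : Type*} [AddCommGroup E]
    [Module ℝ E] [TopologicalSpace E] [IsTopologicalAddGroup E] [ContinuousSMul ℝ E] [T2Space E]
    {X : Set E} (hX_nonempty : X.Nonempty) (hX_convex : Convex ℝ X) (hX_compact : IsCompact X)
    {B : X → Set X} (hB : HasOpenLowerSections B) (hB_nonempty : ∀ x, (B x).Nonempty)
    (hB_convex : ∀ x, ConvexIn (B x)) : ∃ x, x ∈ B x := by
  classical
  have : CompactSpace X := isCompact_iff_compactSpace.1 hX_compact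
  have hcover : Set.univ ⊆ ⋃ y, lowerSection B y := fun x _ => by
    obtain ⟨y, hy⟩ := hB_nonempty x
    exact Set.mem_iUnion.2 ⟨y, hy⟩
  obtain ⟨t, ht⟩ := isCompact_univ.elim_finite_subcover _ hB hcover
  obtain ⟨φ, hφ⟩ := PartitionOfUnity.exists_isSubordinate (s := (Set.univ : Set X)) isClosed_univ
    (fun y : t => lowerSection B y.1) (fun y => hB y.1) fun x hx => by
      obtain ⟨y, hy, hxy⟩ := Set.mem_iUnion₂.1 (ht hx)
      exact Set.mem_iUnion.2 ⟨⟨y, hy⟩, hxy⟩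
  have hsum : ∀ x, ∑ y, φ y x = 1 := fun x => by
    rw [← finsum_eq_sum_of_fintype]
    exact φ.sum_eq_one (Set.mem_univ x)
  have hmem : ∀ x y, φ y x ≠ 0 → y.1 ∈ B x := fun x y h =>
    hφ y (subset_tsupport _ h)
  have hne : Nonempty t := by
    obtain ⟨x, hx⟩ := hX_nonempty
    obtain ⟨y, hy, -⟩ := Set.mem_iUnion₂.1 (ht (Set.mem_univ ⟨x, hx⟩))
    exact ⟨⟨y, hy⟩⟩
  let g : stdSimplex ℝ t → X := fun w => ⟨∑ y, w.1 y • (y.1 : E),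
    hX_convex.sum_mem (fun y _ => w.2.1 y) w.2.2 fun y _ => y.1.2⟩
  have hg : Continuous g := Continuous.subtype_mk
    (continuous_finsetSum _ fun y _ =>
      ((continuous_apply y).comp continuous_subtype_val).smul continuous_const) _
  -- A fixed point `w` exhibits `g w` as a convex combination of those `y` with `φ y (g w) ≠ 0`, all
  -- of which lie in the convex set `B (g w)`.
  let f : stdSimplex ℝ t → stdSimplex ℝ t := fun w =>
    ⟨fun y => φ y (g w), fun y => φ.nonneg y _, hsum _⟩
  have hf : Continuous f := Continuous.subtype_mk
    (continuous_pi fun y => (φ y).continuous.comp hg) _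
  obtain ⟨w, hw⟩ := exists_fixedPoint_stdSimplex f hf
  refine ⟨g w, ?_⟩
  have hval : (g w : E) = ∑ y, φ y (g w) • (y.1 : E) := by
    have h : ∀ y, w.1 y = φ y (g w) := fun y => by
      conv_lhs => rw [← hw]
    exact Finset.sum_congr rfl fun y _ => by rw [h]
  have himg : (g w : E) ∈ (fun x : X => (x : E)) '' B (g w) := by
    rw [hval, ← Finset.sum_filter_of_ne (p := fun y => φ y (g w) ≠ 0)]
    · refine (hB_convex (g w)).sum_mem (fun y _ => φ.nonneg y _) ?_ fun y hy =>
        ⟨y.1, hmem _ y (Finset.mem_filter.1 hy).2, rfl⟩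
      rw [Finset.sum_filter_of_ne fun y _ h => h, hsum]
    · intro y _ h h0
      exact h (by rw [h0, zero_smul])
  obtain ⟨x, hx, he⟩ := himg
  exact Subtype.ext he ▸ hx

theorem theorem3 {E : Type*} [AddCommGroup E] [Module ℝ E] [TopologicalSpace E]
    [IsTopologicalAddGroup E] [ContinuousSMul ℝ E] [LocallyConvexSpace ℝ E] [T2Space E]
    (X : Set E) (hX_nonempty : X.Nonempty) (hX_convex : Convex ℝ X) (hX_compact : IsCompact X)
    (A : X → Set X) (P : X × X → Set X)
    (hA_nonempty : ∀ x : X, (A x).Nonempty)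
    (hA_convex : ∀ x : X, Correspondence.ConvexIn (A x))
    (hA_open : Correspondence.HasOpenLowerSections A)
    (hP_nonempty : ∀ x : X,
      ({y : X | Correspondence.adherence A x ∩ P (x, y) = ∅} ∩ A x).Nonempty)
    (hP_convex : ∀ x : X,
      Correspondence.ConvexIn {y : X | Correspondence.adherence A x ∩ P (x, y) = ∅})
    (hP_open : ∀ y : X, IsOpen {x : X | Correspondence.adherence A x ∩ P (x, y) = ∅}) :
    ∃ x : X, x ∈ A x ∧ A x ∩ P (x, x) = ∅ := by
  obtain ⟨x, hxP, hxA⟩ := Correspondence.HasOpenLowerSections.exists_mem_self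
    hX_nonempty hX_convex hX_compact
    (B := fun x => {y : X | Correspondence.adherence A x ∩ P (x, y) = ∅} ∩ A x)
    (fun y => (hP_open y).inter (hA_open y)) hP_nonempty fun x => by
      rw [Correspondence.ConvexIn, Set.image_inter Subtype.val_injective]
      exact (hP_convex x).inter (hA_convex x)
  refine ⟨x, hxA, Set.subset_empty_iff.1 ?_⟩
  have hsub : A x ⊆ Correspondence.adherence A x := fun y hy =>
    subset_closure (show (x, y) ∈ Correspondence.graph A from hy)
  exact (Set.inter_subset_inter_left _ hsub).trans (show _ = _ from hxP).subset
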